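/- For an integer $s\ge 0$ and a real $\theta\ge 0$, the Curie--Weiss normal (CWN) distribution with parameters $s$ and $\theta$ is the probability distribution on $\mathbb{R}$ whose density is proportional to $y\mapsto\cosh(\sqrt{2\theta}\,y)^s e^{-y^2/2}$. For probability measures $\mu,\nu$ on the same measurable space let $\mathrm{TV}(\mu,\nu)=\sup_A|\mu(A)-\nu(A)|$, the supremum over all measurable sets $A$. Theorem (CWN is close to Gaussian). There are absolute constants $c\in(0,\tfrac12)$ and $C>0$ such that for all integers $n,s\ge 0$ and all real $\theta\ge 0$ with $s\theta<c$ the following holds. If $Y_1,\dots,Y_n$ are i.i.d. with distribution $N(0,(1-2s\theta)^{-1})$ and $Y_1',\dots,Y_n'$ are i.i.d. with the CWN distribution with parameters $s$ and $\theta$, then $$\mathrm{TV}\bigl(\mathcal{L}(Y_1,\dots,Y_n),\,\mathcal{L}(Y_1',\dots,Y_n')\bigr)\le C\sqrt{n\theta^2\sum_{i=1}^5\frac{(s\theta)^i}{(1-2s\theta)^{i-1/2}}}.$$ -/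

import Mathlib

open MeasureTheory ProbabilityTheory

/-- Total variation distance of two (finite) measures: the supremum of `|μ A - ν A|` over all
measurable sets `A`. -/
noncomputable def tvDist {α : Type*} [MeasurableSpace α] (μ ν : Measure α) : ℝ :=
  ⨆ A : {A : Set α // MeasurableSet A}, |μ.real A.1 - ν.real A.1|

/-- The unnormalized Curie-Weiss normal density `cosh (√(2θ) y) ^ s * exp (-y² / 2)`. -/
noncomputable def cwnWeight (s : ℕ) (θ : ℝ) (y : ℝ) : ℝ :=
  Real.cosh (√(2 * θ) * y) ^ s * Real.exp (-y ^ 2 / 2)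

/-- The normalizing constant of the Curie-Weiss normal density. -/
noncomputable def cwnConst (s : ℕ) (θ : ℝ) : ℝ := ∫ y : ℝ, cwnWeight s θ y

/-- The Curie-Weiss normal distribution with parameters `s` and `θ`. -/
noncomputable def cwn (s : ℕ) (θ : ℝ) : Measure ℝ :=
  volume.withDensity fun y => ENNReal.ofReal (cwnWeight s θ y / cwnConst s θ)

theorem cwnWeight_pos (s : ℕ) (θ y : ℝ) : 0 < cwnWeight s θ y :=
  mul_pos (pow_pos (Real.cosh_pos _) s) (Real.exp_pos _)

theorem continuous_cwnWeight (s : ℕ) (θ : ℝ) : Continuous (cwnWeight s θ) := by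
  unfold cwnWeight
  exact ((Real.continuous_cosh.comp (by fun_prop)).pow s).mul (by fun_prop)

theorem integrable_cwnWeight (s : ℕ) (θ : ℝ) : Integrable (cwnWeight s θ) := by
  have hg : Integrable fun y : ℝ =>
      Real.exp ((s * √(2 * θ)) ^ 2) * Real.exp (-(1 / 4) * y ^ 2) :=
    (integrable_exp_neg_mul_sq (by norm_num)).const_mul _
  refine hg.mono' (continuous_cwnWeight s θ).aestronglyMeasurable
    (Filter.Eventually.of_forall fun y => ?_)
  rw [Real.norm_of_nonneg (cwnWeight_pos s θ y).le]
  have h1 : Real.cosh (√(2 * θ) * y) ≤ Real.exp (√(2 * θ) * |y|) := by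
    have h0 : |√(2 * θ) * y| = √(2 * θ) * |y| := by
      rw [abs_mul, abs_of_nonneg (Real.sqrt_nonneg _)]
    rw [← Real.cosh_abs, h0, Real.cosh_eq]
    have : Real.exp (-(√(2 * θ) * |y|)) ≤ Real.exp (√(2 * θ) * |y|) :=
      Real.exp_le_exp.2 (neg_le_self (by positivity))
    linarith
  have h2 : Real.cosh (√(2 * θ) * y) ^ s ≤ Real.exp (s * (√(2 * θ) * |y|)) := by
    rw [Real.exp_nat_mul]
    exact pow_le_pow_left₀ (Real.cosh_pos _).le h1 s
  calc cwnWeight s θ y ≤ Real.exp (s * (√(2 * θ) * |y|)) * Real.exp (-y ^ 2 / 2) :=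
        mul_le_mul_of_nonneg_right h2 (Real.exp_pos _).le
    _ ≤ _ := by
        rw [← Real.exp_add, ← Real.exp_add]
        refine Real.exp_le_exp.2 ?_
        nlinarith [sq_nonneg (s * √(2 * θ) - |y| / 2), sq_abs y]

theorem cwnConst_pos (s : ℕ) (θ : ℝ) : 0 < cwnConst s θ := by
  refine integral_pos_of_integrable_nonneg_nonzero (x := 0) (continuous_cwnWeight s θ)
    (integrable_cwnWeight s θ) (fun y => (cwnWeight_pos s θ y).le) (cwnWeight_pos s θ 0).ne'

/-- The Curie-Weiss normal distribution has total mass one. -/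
instance isProbabilityMeasure_cwn (s : ℕ) (θ : ℝ) : IsProbabilityMeasure (cwn s θ) := by
  constructor
  rw [cwn, withDensity_apply _ MeasurableSet.univ, Measure.restrict_univ,
    ← ofReal_integral_eq_lintegral_ofReal ((integrable_cwnWeight s θ).div_const _)
      (Filter.Eventually.of_forall fun y =>
        div_nonneg (cwnWeight_pos s θ y).le (cwnConst_pos s θ).le),
    integral_div]
  change ENNReal.ofReal (cwnConst s θ / cwnConst s θ) = 1
  rw [div_self (cwnConst_pos s θ).ne', ENNReal.ofReal_one]

/-! Put x = √(2θ) y. Completing the exponent with e^{sθy²} shows that CWN has density proportional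
to r(y) = (cosh x · e^{-x²/2})^s with respect to γ = N(0, (1-2sθ)⁻¹). The Gaussian factor cancels
the quadratic term of log cosh, so r differs from 1 only at fourth order: 1 - sθ²y⁴ ≤ r ≤ 1
(`one_sub_cwnRatio_le`). As the moments of γ are bounded, the chi-square divergence of CWN from γ is
O((sθ²)²) (`integral_sq_cwnRatio_div_sub_one_le`).

Total variation is at most the root of chi-square, and 1 + chi-square is multiplicative over
products; hence the distance of the n-fold products is O(√(n(sθ²)²)) (`tvDist_pi_withDensity_le`).
Since (sθ²)² = θ²(sθ)² ≤ θ²·sθ, the term i = 1 of the sum already suffices. -/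

/-- The square of the mean is at most the mean of the square. -/
theorem sq_integral_abs_le_integral_sq {α : Type*} [MeasurableSpace α] {μ : Measure α}
    [IsProbabilityMeasure μ] {f : α → ℝ} (hf : MemLp f 2 μ) :
    (∫ x, |f x| ∂μ) ^ 2 ≤ ∫ x, f x ^ 2 ∂μ := by
  have h := variance_eq_sub hf.abs
  have h0 := variance_nonneg |f| μ
  rw [h] at h0
  simpa using h0

theorem integral_sub_const_sq {α : Type*} [MeasurableSpace α] {μ : Measure α}
    [IsProbabilityMeasure μ] {f : α → ℝ} (hf : MemLp f 2 μ) (c : ℝ) :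
    ∫ x, (f x - c) ^ 2 ∂μ = ∫ x, f x ^ 2 ∂μ - 2 * c * ∫ x, f x ∂μ + c ^ 2 := by
  have hi : Integrable (fun x => 2 * c * f x) μ := (hf.integrable (by norm_num)).const_mul _
  have hsub : Integrable (fun x => f x ^ 2 - 2 * c * f x) μ := hf.integrable_sq.sub hi
  have h : ∀ x, (f x - c) ^ 2 = f x ^ 2 - 2 * c * f x + c ^ 2 := fun x => by ring
  simp_rw [h]
  rw [integral_add hsub (integrable_const _), integral_sub hf.integrable_sq hi,
    integral_const_mul]
  simp

/-- The total variation distance between `μ` and the measure with density `f` with respect to `μ`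
is bounded by the `L²` distance of `f` to one. -/
theorem tvDist_withDensity_le {α : Type*} [MeasurableSpace α] {μ : Measure α}
    [IsProbabilityMeasure μ] {f : α → ℝ} (hf0 : ∀ x, 0 ≤ f x) (hf : MemLp f 2 μ) :
    tvDist μ (μ.withDensity fun x => ENNReal.ofReal (f x)) ≤ √(∫ x, (f x - 1) ^ 2 ∂μ) := by
  have hi : Integrable f μ := hf.integrable (by norm_num)
  have hd : MemLp (fun x => f x - 1) 2 μ := hf.sub (memLp_const 1)
  have hdi : Integrable (fun x => f x - 1) μ := hi.sub (integrable_const 1)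
  refine Real.iSup_le (fun ⟨A, hA⟩ => ?_) (Real.sqrt_nonneg _)
  have hν : (μ.withDensity fun x => ENNReal.ofReal (f x)).real A = ∫ x in A, f x ∂μ := by
    rw [measureReal_def, withDensity_apply _ hA, ← ofReal_integral_eq_lintegral_ofReal
      hi.integrableOn (Filter.Eventually.of_forall hf0),
      ENNReal.toReal_ofReal (integral_nonneg hf0)]
  have hμ : μ.real A = ∫ x in A, (1 : ℝ) ∂μ := by simp
  refine Real.le_sqrt_of_sq_le (le_trans ?_ (sq_integral_abs_le_integral_sq hd))
  gcongr
  rw [abs_sub_comm]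
  simp only [hν, hμ]
  rw [← integral_sub hi.integrableOn (integrable_const 1)]
  exact (abs_integral_le_integral_abs).trans
    (setIntegral_le_integral hdi.abs (Filter.Eventually.of_forall fun _ => abs_nonneg _))

/-- A finite product of measures with density is the product measure with the product density. -/
theorem pi_withDensity_ofReal {ι E : Type*} [Fintype ι] [MeasurableSpace E] {μ : Measure E}
    [IsProbabilityMeasure μ] {f : E → ℝ} (hf0 : ∀ x, 0 ≤ f x) (hf : Integrable f μ) :
    (Measure.pi fun _ : ι => μ.withDensity fun x => ENNReal.ofReal (f x)) =
      (Measure.pi fun _ : ι => μ).withDensity fun x => ENNReal.ofReal (∏ i, f (x i)) := by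
  have : IsFiniteMeasure (μ.withDensity fun x => ENNReal.ofReal (f x)) :=
    isFiniteMeasure_withDensity_ofReal hf.2
  refine Measure.pi_eq fun s hs => ?_
  rw [withDensity_apply _ (MeasurableSet.univ_pi hs), Measure.restrict_pi_pi,
    ← ofReal_integral_eq_lintegral_ofReal
      (Integrable.fintype_prod (f := fun _ => f) fun i => hf.integrableOn)
      (Filter.Eventually.of_forall fun x => Finset.prod_nonneg fun i _ => hf0 _),
    integral_fintype_prod_eq_prod (fun _ => f),
    ENNReal.ofReal_prod_of_nonneg fun i _ => integral_nonneg hf0]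
  refine Finset.prod_congr rfl fun i _ => ?_
  rw [withDensity_apply _ (hs i), ofReal_integral_eq_lintegral_ofReal hf.integrableOn
    (Filter.Eventually.of_forall hf0)]

theorem tvDist_le_one {α : Type*} [MeasurableSpace α] (μ ν : Measure α)
    [IsProbabilityMeasure μ] [IsProbabilityMeasure ν] : tvDist μ ν ≤ 1 := by
  refine Real.iSup_le (fun A => ?_) zero_le_one
  rw [abs_le]
  constructor <;> linarith [measureReal_nonneg (μ := μ) (s := A.1),
    measureReal_nonneg (μ := ν) (s := A.1), measureReal_le_one (μ := μ) (s := A.1),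
    measureReal_le_one (μ := ν) (s := A.1)]

/-- Tensorized chi-square bound for the total variation distance. -/
theorem tvDist_pi_withDensity_le {E : Type*} [MeasurableSpace E] {μ : Measure E}
    [IsProbabilityMeasure μ] {f : E → ℝ} (hf0 : ∀ x, 0 ≤ f x) (hf : MemLp f 2 μ)
    (hf1 : ∫ x, f x ∂μ = 1) {δ : ℝ} (hδ : ∫ x, (f x - 1) ^ 2 ∂μ ≤ δ) (n : ℕ) :
    tvDist (Measure.pi fun _ : Fin n => μ)
      (Measure.pi fun _ : Fin n => μ.withDensity fun x => ENNReal.ofReal (f x)) ≤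
        √(2 * (n * δ)) := by
  have hi : Integrable f μ := hf.integrable (by norm_num)
  have hi2 : Integrable (fun x => f x ^ 2) μ := hf.integrable_sq
  have hδ0 : 0 ≤ δ := (integral_nonneg fun x => sq_nonneg _).trans hδ
  have hprob : IsProbabilityMeasure (μ.withDensity fun x => ENNReal.ofReal (f x)) := by
    constructor
    rw [withDensity_apply _ MeasurableSet.univ, Measure.restrict_univ,
      ← ofReal_integral_eq_lintegral_ofReal hi (Filter.Eventually.of_forall hf0), hf1,
      ENNReal.ofReal_one]
  -- For nδ ≥ 1 the bound exceeds 1 and is trivial. Otherwise e^t - 1 ≤ 2t at t = nδ, which is the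
  -- source of the factor 2.
  rcases le_or_gt 1 (n * δ) with h | h
  · refine (tvDist_le_one _ _).trans (Real.le_sqrt_of_sq_le (by linarith))
  have hF : Integrable (fun x : Fin n → E => ∏ i, f (x i)) (Measure.pi fun _ => μ) :=
    Integrable.fintype_prod (f := fun _ => f) fun _ => hi
  have hF2 : Integrable (fun x : Fin n → E => (∏ i, f (x i)) ^ 2) (Measure.pi fun _ => μ) := by
    simp_rw [← Finset.prod_pow]
    exact Integrable.fintype_prod (f := fun _ x => f x ^ 2) fun _ => hi2
  have hFL : MemLp (fun x : Fin n → E => ∏ i, f (x i)) 2 (Measure.pi fun _ => μ) :=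
    (memLp_two_iff_integrable_sq hF.aestronglyMeasurable).2 hF2
  rw [pi_withDensity_ofReal hf0 hi]
  refine (tvDist_withDensity_le (fun x => Finset.prod_nonneg fun i _ => hf0 _) hFL).trans
    (Real.sqrt_le_sqrt ?_)
  have hsq : ∫ x, f x ^ 2 ∂μ ≤ 1 + δ := by
    have := integral_sub_const_sq hf 1
    rw [hf1] at this
    linarith
  have hint : ∫ x : Fin n → E, ((∏ i, f (x i)) - 1) ^ 2 ∂(Measure.pi fun _ => μ) =
      (∫ x, f x ^ 2 ∂μ) ^ n - 1 := by
    rw [integral_sub_const_sq hFL, integral_fintype_prod_eq_pow, hf1]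
    simp_rw [← Finset.prod_pow]
    rw [integral_fintype_prod_eq_pow (fun x => f x ^ 2), Fintype.card_fin]
    ring
  rw [hint]
  have h1 : (∫ x, f x ^ 2 ∂μ) ^ n ≤ Real.exp (n * δ) := by
    rw [Real.exp_nat_mul]
    exact pow_le_pow_left₀ (integral_nonneg fun x => sq_nonneg _)
      (hsq.trans (by linarith [Real.add_one_le_exp δ])) n
  have h2 := Real.abs_exp_sub_one_le (x := n * δ) (by rw [abs_of_nonneg (by positivity)]; exact h.le)
  rw [abs_of_nonneg (a := n * δ) (by positivity)] at h2
  linarith [le_abs_self (Real.exp (n * δ) - 1)]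

/-! ### Gaussian moments -/

theorem integrable_pow_gaussianReal (v : NNReal) (k : ℕ) :
    Integrable (fun y : ℝ => y ^ k) (gaussianReal 0 v) :=
  integrable_pow_of_mem_interior_integrableExpSet (X := id) (by simp) k

/-- Crude bound for the even moments of a centred Gaussian. -/
theorem integral_pow_gaussianReal_le {v : NNReal} (hv : v ≤ 2) {k : ℕ} (hk : Even k) :
    ∫ y, y ^ k ∂(gaussianReal 0 v) ≤ k.factorial * 6 := by
  have hexp (t : ℝ) (ht : t ^ 2 = 1) : ∫ y, Real.exp (t * y) ∂(gaussianReal 0 v) ≤ 3 := by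
    have h := congrFun (mgf_fun_id_gaussianReal (μ := 0) (v := v)) t
    simp only [mgf, zero_mul, zero_add, ht, mul_one] at h
    rw [h]
    have hv' : (v : ℝ) ≤ 2 := by exact_mod_cast hv
    have : Real.exp (v / 2) ≤ Real.exp 1 := Real.exp_le_exp.2 (by linarith)
    linarith [Real.exp_one_lt_d9]
  have i1 := integrable_exp_mul_gaussianReal (μ := 0) (v := v) 1
  have i2 := integrable_exp_mul_gaussianReal (μ := 0) (v := v) (-1)
  calc ∫ y, y ^ k ∂(gaussianReal 0 v)
      ≤ ∫ y, k.factorial * (Real.exp (1 * y) + Real.exp (-1 * y)) ∂(gaussianReal 0 v) := by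
        refine integral_mono (integrable_pow_gaussianReal v k) ((i1.add i2).const_mul _)
          fun y => ?_
        -- For even k, y^k / k! ≤ e^{|y|} ≤ e^y + e^{-y}, and each exponential has mean e^{v/2} ≤ e
        -- < 3.
        have h := Real.pow_div_factorial_le_exp |y| (abs_nonneg y) k
        rw [hk.pow_abs, div_le_iff₀' (by positivity)] at h
        refine h.trans ?_
        gcongr
        rw [one_mul, neg_one_mul]
        rcases abs_cases y with ⟨h, _⟩ | ⟨h, _⟩ <;> rw [h] <;>
          linarith [Real.exp_pos y, Real.exp_pos (-y)]
    _ ≤ k.factorial * 6 := by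
        rw [integral_const_mul, integral_add i1 i2]
        gcongr
        linarith [hexp 1 (by norm_num), hexp (-1) (by norm_num)]

/-! ### The density of CWN relative to the Gaussian -/

/-- Follows from cosh x = 1 + 2 sinh²(x/2) and |sinh t| ≥ |t|. -/
theorem one_add_half_sq_le_cosh (x : ℝ) : 1 + x ^ 2 / 2 ≤ Real.cosh x := by
  have h := Real.cosh_two_mul (x / 2)
  have h1 := Real.cosh_sq (x / 2)
  have h2 : (x / 2) ^ 2 ≤ Real.sinh (x / 2) ^ 2 := by
    rw [sq_le_sq, Real.abs_sinh]
    exact Real.self_le_sinh_iff.2 (abs_nonneg _)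
  rw [show 2 * (x / 2) = x by ring] at h
  linarith

/-- The ratio of the Curie-Weiss normal weight to the Gaussian weight of matching second order. -/
noncomputable def cwnRatio (s : ℕ) (θ y : ℝ) : ℝ :=
  (Real.cosh (√(2 * θ) * y) * Real.exp (-(√(2 * θ) * y) ^ 2 / 2)) ^ s

theorem cwnRatio_nonneg (s : ℕ) (θ y : ℝ) : 0 ≤ cwnRatio s θ y :=
  pow_nonneg (mul_nonneg (Real.cosh_pos _).le (Real.exp_pos _).le) s

theorem cosh_mul_exp_neg_half_sq_le_one (x : ℝ) :
    Real.cosh x * Real.exp (-x ^ 2 / 2) ≤ 1 := by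
  calc _ ≤ Real.exp (x ^ 2 / 2) * Real.exp (-x ^ 2 / 2) := by
        gcongr
        exact Real.cosh_le_exp_half_sq x
    _ = 1 := by rw [← Real.exp_add]; simp [neg_div]

theorem cwnRatio_le_one (s : ℕ) (θ y : ℝ) : cwnRatio s θ y ≤ 1 :=
  pow_le_one₀ (mul_nonneg (Real.cosh_pos _).le (Real.exp_pos _).le)
    (cosh_mul_exp_neg_half_sq_le_one _)

theorem continuous_cwnRatio (s : ℕ) (θ : ℝ) : Continuous (cwnRatio s θ) := by
  unfold cwnRatio
  exact ((Real.continuous_cosh.comp (by fun_prop)).mul (by fun_prop)).pow s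

/-- The base u of the power satisfies u ≥ (1 + x²/2)(1 - x²/2) = 1 - x⁴/4 = 1 - θ²y⁴; Bernoulli's
inequality then passes to u^s. -/
theorem one_sub_cwnRatio_le (s : ℕ) {θ : ℝ} (hθ : 0 ≤ θ) (y : ℝ) :
    1 - cwnRatio s θ y ≤ s * θ ^ 2 * y ^ 4 := by
  set x := √(2 * θ) * y with hx
  have hx2 : x ^ 2 = 2 * θ * y ^ 2 := by rw [hx, mul_pow, Real.sq_sqrt (by positivity)]
  set u := Real.cosh x * Real.exp (-x ^ 2 / 2) with hu
  have hu0 : 0 ≤ u := mul_nonneg (Real.cosh_pos _).le (Real.exp_pos _).le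
  have h1 : 1 - θ ^ 2 * y ^ 4 ≤ u := by
    have h2 := one_add_half_sq_le_cosh x
    have h3 := Real.add_one_le_exp (-x ^ 2 / 2)
    calc 1 - θ ^ 2 * y ^ 4 = (1 + x ^ 2 / 2) * (-x ^ 2 / 2 + 1) := by
          rw [neg_div, hx2]; ring
      _ ≤ (1 + x ^ 2 / 2) * Real.exp (-x ^ 2 / 2) := by gcongr
      _ ≤ u := by rw [hu]; gcongr
  have h4 := one_add_mul_le_pow (a := u - 1) (by linarith) s
  rw [add_sub_cancel] at h4
  have h5 : (s : ℝ) * (1 - u) ≤ s * (θ ^ 2 * y ^ 4) := by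
    gcongr; linarith
  change 1 - u ^ s ≤ _
  linarith

theorem cwnWeight_eq_gaussianPDFReal_mul_cwnRatio (s : ℕ) {θ : ℝ} (hθ : 0 ≤ θ)
    (h : 2 * s * θ < 1) (y : ℝ) :
    cwnWeight s θ y = √(2 * Real.pi * (Real.toNNReal (1 - 2 * s * θ)⁻¹)) *
      (gaussianPDFReal 0 (Real.toNNReal (1 - 2 * s * θ)⁻¹) y * cwnRatio s θ y) := by
  have hp : 0 < 1 - 2 * s * θ := by linarith
  have hpi := Real.pi_pos
  have hs : (√(2 * θ) * y) ^ 2 = 2 * θ * y ^ 2 := by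
    rw [mul_pow, Real.sq_sqrt (by positivity)]
  have hsq : √(2 * Real.pi * (1 - 2 * s * θ)⁻¹) ≠ 0 := by positivity
  rw [gaussianPDFReal_def, cwnRatio, cwnWeight, Real.coe_toNNReal _ (by positivity), mul_pow,
    ← Real.exp_nat_mul]
  have he : Real.exp (-y ^ 2 / 2) = Real.exp (-(y - 0) ^ 2 / (2 * (1 - 2 * s * θ)⁻¹)) *
      Real.exp (s * (-(√(2 * θ) * y) ^ 2 / 2)) := by
    rw [← Real.exp_add, neg_div ((2 : ℝ)) ((√(2 * θ) * y) ^ 2), hs]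
    congr 1
    field_simp
    ring
  rw [he]
  generalize √(2 * Real.pi * (1 - 2 * s * θ)⁻¹) = q at hsq
  field_simp

theorem integrable_cwnRatio (s : ℕ) (θ : ℝ) (μ : Measure ℝ) [IsProbabilityMeasure μ] :
    Integrable (cwnRatio s θ) μ :=
  Integrable.of_bound (continuous_cwnRatio s θ).aestronglyMeasurable 1
    (Filter.Eventually.of_forall fun y => by
      rw [Real.norm_of_nonneg (cwnRatio_nonneg s θ y)]
      exact cwnRatio_le_one s θ y)

theorem memLp_cwnRatio (s : ℕ) (θ : ℝ) (μ : Measure ℝ) [IsProbabilityMeasure μ] :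
    MemLp (cwnRatio s θ) 2 μ :=
  MemLp.of_bound (continuous_cwnRatio s θ).aestronglyMeasurable 1
    (Filter.Eventually.of_forall fun y => by
      rw [Real.norm_of_nonneg (cwnRatio_nonneg s θ y)]
      exact cwnRatio_le_one s θ y)

/-- The Curie-Weiss normal distribution has normalized density `cwnRatio` with respect to the
Gaussian. -/
theorem cwn_eq_withDensity_gaussianReal (s : ℕ) {θ : ℝ} (hθ : 0 ≤ θ) (h : 2 * s * θ < 1) :
    cwn s θ = (gaussianReal 0 (Real.toNNReal (1 - 2 * s * θ)⁻¹)).withDensity fun y =>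
      ENNReal.ofReal (cwnRatio s θ y /
        ∫ z, cwnRatio s θ z ∂(gaussianReal 0 (Real.toNNReal (1 - 2 * s * θ)⁻¹))) := by
  have hw := cwnWeight_eq_gaussianPDFReal_mul_cwnRatio s hθ h
  have hv : Real.toNNReal (1 - 2 * s * θ)⁻¹ ≠ 0 := by
    have : 0 < (1 - 2 * s * θ)⁻¹ := inv_pos.2 (by linarith)
    exact (Real.toNNReal_pos.2 this).ne'
  set v := Real.toNNReal (1 - 2 * s * θ)⁻¹
  have hk : √(2 * Real.pi * v) ≠ 0 := by
    have := NNReal.coe_pos.2 (pos_iff_ne_zero.2 hv)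
    have := Real.pi_pos
    positivity
  have hc : cwnConst s θ = √(2 * Real.pi * v) * ∫ z, cwnRatio s θ z ∂(gaussianReal 0 v) := by
    rw [cwnConst, integral_gaussianReal_eq_integral_smul hv, ← integral_const_mul]
    exact integral_congr_ae (Filter.Eventually.of_forall hw)
  rw [gaussianReal_of_var_ne_zero 0 hv, ← withDensity_mul _ (measurable_gaussianPDF 0 v)
    ((continuous_cwnRatio s θ).measurable.div_const _).ennreal_ofReal,
    ← gaussianReal_of_var_ne_zero 0 hv, cwn]
  congr 1
  ext y
  rw [Pi.mul_apply, gaussianPDF, ← ENNReal.ofReal_mul (gaussianPDFReal_nonneg _ _ _), hc, hw y,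
    mul_div_mul_left _ _ hk, mul_div_assoc]

/-- Chi-square bound for the normalized density. -/
theorem integral_sq_cwnRatio_div_sub_one_le {s : ℕ} {θ : ℝ} (hθ : 0 ≤ θ) (hs : s * θ ^ 2 ≤ 1 / 400)
    {v : NNReal} (hv : v ≤ 2) :
    0 < ∫ z, cwnRatio s θ z ∂(gaussianReal 0 v) ∧
    ∫ y, (cwnRatio s θ y / (∫ z, cwnRatio s θ z ∂(gaussianReal 0 v)) - 1) ^ 2
      ∂(gaussianReal 0 v) ≤ 1000000 * (s * θ ^ 2) ^ 2 := by
  set γ := gaussianReal 0 v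
  set a := ∫ z, cwnRatio s θ z ∂γ with ha_def
  have hL := memLp_cwnRatio s θ γ
  have hi := integrable_cwnRatio s θ γ
  have hb0 : 0 ≤ s * θ ^ 2 := by positivity
  -- The fourth moment is at most 4!·6 = 144, so 1 - a ≤ 144/400 < 1/2.
  have ha : 1 / 2 ≤ a := by
    have h4 := integral_pow_gaussianReal_le hv (k := 4) (by decide)
    have hm : ∫ y, (1 - cwnRatio s θ y) ∂γ ≤ ∫ y, s * θ ^ 2 * y ^ 4 ∂γ :=
      integral_mono ((integrable_const 1).sub hi)
        ((integrable_pow_gaussianReal v 4).const_mul _) (one_sub_cwnRatio_le s hθ)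
    rw [integral_sub (integrable_const 1) hi, integral_const_mul] at hm
    simp only [integral_const, probReal_univ, smul_eq_mul, mul_one] at hm
    norm_num [Nat.factorial] at h4
    nlinarith
  refine ⟨by linarith, ?_⟩
  -- The mean a minimizes the mean squared deviation, so centring at 1 instead can only increase it.
  have hvar : ∫ y, (cwnRatio s θ y - a) ^ 2 ∂γ ≤ ∫ y, (1 - cwnRatio s θ y) ^ 2 ∂γ := by
    have h1 := integral_sub_const_sq hL 1
    simp_rw [sub_sq_comm _ (1 : ℝ)] at h1
    rw [integral_sub_const_sq hL, h1]
    nlinarith [sq_nonneg (a - 1)]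
  have hsq : ∫ y, (1 - cwnRatio s θ y) ^ 2 ∂γ ≤ 241920 * (s * θ ^ 2) ^ 2 := by
    have h8 := integral_pow_gaussianReal_le hv (k := 8) (by decide)
    calc _ ≤ ∫ y, (s * θ ^ 2) ^ 2 * y ^ 8 ∂γ := by
          refine integral_mono (((memLp_const 1).sub hL).integrable_sq)
            ((integrable_pow_gaussianReal v 8).const_mul _) fun y => ?_
          calc _ ≤ (s * θ ^ 2 * y ^ 4) ^ 2 := pow_le_pow_left₀
                (by linarith [cwnRatio_le_one s θ y]) (one_sub_cwnRatio_le s hθ y) 2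
            _ = (s * θ ^ 2) ^ 2 * y ^ 8 := by ring
      _ = (s * θ ^ 2) ^ 2 * ∫ y, y ^ 8 ∂γ := integral_const_mul _ _
      _ ≤ (s * θ ^ 2) ^ 2 * 241920 := by
          gcongr
          norm_num [Nat.factorial] at h8
          exact h8
      _ = _ := mul_comm _ _
  have hdiv : ∀ y, (cwnRatio s θ y / a - 1) ^ 2 = (a ^ 2)⁻¹ * (cwnRatio s θ y - a) ^ 2 :=
    fun y => by
      have : a ≠ 0 := by linarith
      field_simp
  simp_rw [hdiv]
  rw [integral_const_mul]
  have hinv : (a ^ 2)⁻¹ ≤ 4 := by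
    rw [inv_le_comm₀ (by positivity) (by norm_num)]
    nlinarith
  calc _ ≤ 4 * (241920 * (s * θ ^ 2) ^ 2) := by
        gcongr
        exact hvar.trans hsq
    _ ≤ _ := by nlinarith [sq_nonneg (s * θ ^ 2)]

/-! ### Conclusion -/

/-- The term i = 1 is t / √(1 - 2t) ≥ t, and the other terms are nonnegative. -/
theorem le_sum_div_rpow {t : ℝ} (ht0 : 0 ≤ t) (ht : 2 * t < 1) :
    t ≤ ∑ i ∈ Finset.Icc (1 : ℕ) 5, t ^ i / (1 - 2 * t) ^ ((i : ℝ) - 1 / 2) := by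
  have hp : 0 < 1 - 2 * t := by linarith
  have h0 : ∀ i ∈ Finset.Icc (1 : ℕ) 5, 0 ≤ t ^ i / (1 - 2 * t) ^ ((i : ℝ) - 1 / 2) :=
    fun i _ => div_nonneg (pow_nonneg ht0 i) (Real.rpow_nonneg hp.le _)
  refine le_trans ?_ (Finset.single_le_sum h0 (show 1 ∈ Finset.Icc (1 : ℕ) 5 by simp))
  rw [pow_one]
  exact le_div_self ht0 (Real.rpow_pos_of_pos hp _)
    (Real.rpow_le_one hp.le (by linarith) (by norm_num))

theorem tvDist_pi_gaussianReal_cwn_le (n s : ℕ) {θ : ℝ} (hθ : 0 ≤ θ) (hs : s * θ < 1 / 20) :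
    tvDist (Measure.pi fun _ : Fin n => gaussianReal 0 (Real.toNNReal (1 - 2 * s * θ)⁻¹))
      (Measure.pi fun _ : Fin n => cwn s θ) ≤ 2000 * √(n * θ ^ 2 * (s * θ)) := by
  have hsθ : 0 ≤ s * θ := by positivity
  have h1 : 2 * s * θ < 1 := by linarith
  -- Integrality of s enters here: s ≥ 1 gives θ ≤ sθ, so sθ² ≤ (sθ)² < 1/400.
  have hsq : s * θ ^ 2 ≤ 1 / 400 := by
    rcases Nat.eq_zero_or_pos s with rfl | hpos
    · norm_num
    have h1s : (1 : ℝ) ≤ s := by exact_mod_cast hpos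
    have : θ ≤ s * θ := le_mul_of_one_le_left hθ h1s
    nlinarith
  have hv : Real.toNNReal (1 - 2 * s * θ)⁻¹ ≤ 2 := by
    rw [Real.toNNReal_le_iff_le_coe]
    rw [inv_le_comm₀ (by linarith) (by norm_num)]
    norm_num
    linarith
  rw [cwn_eq_withDensity_gaussianReal s hθ h1]
  obtain ⟨ha, hδ⟩ := integral_sq_cwnRatio_div_sub_one_le hθ hsq hv
  refine (tvDist_pi_withDensity_le (fun y => div_nonneg (cwnRatio_nonneg s θ y) ha.le)
    ?_ ?_ hδ n).trans ?_
  · simpa only [div_eq_mul_inv] using (memLp_cwnRatio s θ (gaussianReal 0 _)).mul_const _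
  · rw [integral_div, div_self ha.ne']
  · refine Real.sqrt_le_iff.2 ⟨by positivity, ?_⟩
    rw [mul_pow 2000, Real.sq_sqrt (by positivity)]
    have : (s * θ) ^ 2 ≤ s * θ := by nlinarith
    calc 2 * (n * (1000000 * (s * θ ^ 2) ^ 2)) = 2000000 * (n * θ ^ 2 * (s * θ) ^ 2) := by ring
      _ ≤ 2000000 * (n * θ ^ 2 * (s * θ)) := by gcongr
      _ ≤ _ := by
        have : 0 ≤ n * θ ^ 2 * (s * θ) := by positivity
        linarith

theorem mainTheorem5 :
    ∃ c : ℝ, 0 < c ∧ c < 1 / 2 ∧ ∃ C : ℝ, 0 < C ∧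
      ∀ (n s : ℕ) (θ : ℝ), 0 ≤ θ → (s : ℝ) * θ < c →
      ∀ (Ω Ω' : Type*) [MeasurableSpace Ω] [MeasurableSpace Ω']
        (P : Measure Ω) [IsProbabilityMeasure P] (P' : Measure Ω') [IsProbabilityMeasure P']
        (Y : Fin n → Ω → ℝ) (Y' : Fin n → Ω' → ℝ),
        iIndepFun Y P →
        (∀ i, HasLaw (Y i) (gaussianReal 0 (Real.toNNReal (1 - 2 * s * θ)⁻¹)) P) →
        iIndepFun Y' P' →
        (∀ i, HasLaw (Y' i) (cwn s θ) P') →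
        tvDist (P.map fun ω i => Y i ω) (P'.map fun ω i => Y' i ω) ≤
          C * √(n * θ ^ 2 * ∑ i ∈ Finset.Icc (1 : ℕ) 5,
            ((s : ℝ) * θ) ^ i / (1 - 2 * s * θ) ^ ((i : ℝ) - 1 / 2)) := by
  -- The value 1/20 keeps the variance below 2 and sθ² below 1/400; 2000 works because 2·10⁶ ≤
  -- 2000².
  refine ⟨1 / 20, by norm_num, by norm_num, 2000, by norm_num, ?_⟩
  intro n s θ hθ hs Ω Ω' _ _ P _ P' _ Y Y' hY hYlaw hY' hYlaw'
  rw [hY.map_fun_eq_pi_map fun i => (hYlaw i).aemeasurable,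
    hY'.map_fun_eq_pi_map fun i => (hYlaw' i).aemeasurable]
  simp_rw [fun i => (hYlaw i).map_eq, fun i => (hYlaw' i).map_eq]
  refine (tvDist_pi_gaussianReal_cwn_le n s hθ hs).trans ?_
  have h0 : 0 ≤ s * θ := by positivity
  have h := le_sum_div_rpow h0 (by linarith)
  rw [← mul_assoc] at h
  gcongr
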